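/- Let $\mathbf{Pos}$, $\mathbf{Ac}$ and $\mathbf{Cat}$ be the categories of posets, of small acyclic categories (small categories in which only identities are invertible and every endomorphism is an identity) and of all small categories. A poset $P$ is regarded as a small (acyclic) category with exactly one arrow $x\to y$ if $x\le y$ and none otherwise. Each of the three categories carries its Thomason model structure, which is transferred from the Quillen model structure on simplicial sets along $\mathrm{Ex}^2N$, where $N$ is the nerve functor and $\mathrm{Ex}$ is the right adjoint of the barycentric subdivision $\mathrm{Sd}$: the trivial fibrations are the morphisms $f$ such that $\mathrm{Ex}^2N(f)$ has the right lifting property with respect to all boundary inclusions $\partial\Delta^n\to\Delta^n$, $n\ge 0$, and the cofibrations are the morphisms having the left lifting property with respect to all trivial fibrations. (In $\mathbf{Cat}$, with $\tau_1$ the left adjoint of $N$, these are the cofibrations cofibrantly generated by the morphisms $\tau_1\mathrm{Sd}^2\partial\Delta^n\to\tau_1\mathrm{Sd}^2\Delta^n$.) An object is cofibrant if the unique morphism from the initial object to it is a cofibration. **Theorem.** Let $P$ be a poset with at most five elements. Then, in each of the three Thomason model structures (on $\mathbf{Pos}$, $\mathbf{Ac}$ and $\mathbf{Cat}$), $P$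 is cofibrant, and for every minimal element $m$ of $P$ the morphism $\ast\to P$ from the terminal object (the one-element poset) with value $m$ is a cofibration. -/

import Mathlib

open CategoryTheory Limits HomotopicalAlgebra

universe u

namespace Thomason

/-! ### The Thomason cofibrations

The Thomason model structures on small categories, small acyclic categories and posets are all
transferred from the Quillen model structure on simplicial sets along `Ex² N`, where `N` is the
nerve and `Ex` is the right adjoint of the barycentric subdivision `Sd`. -/

section Transfer

variable {C : Type*} [Category* C]

/-- The trivial fibrations of the model structure transferred along `Ex² N`: the morphisms `f`
such that `Ex² N f` is a trivial Kan fibration, i.e. has the right lifting property with respect to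
all boundary inclusions `∂Δ[n] ⟶ Δ[n]`. -/
def trivialFibrations (N : C ⥤ SSet.{u}) : MorphismProperty C :=
  SSet.modelCategoryQuillen.I.{u}.rlp.inverseImage (N ⋙ SSet.ex ⋙ SSet.ex)

/-- The cofibrations of the model structure transferred along `Ex² N`: the morphisms having the
left lifting property with respect to all trivial fibrations. -/
def cofibrations (N : C ⥤ SSet.{u}) : MorphismProperty C :=
  (trivialFibrations N).llp

/-- For a functor `L` from simplicial sets (e.g. the fundamental category functor `τ₁`), the family
of the morphisms `L Sd² (∂Δ[n] ⟶ Δ[n])`. -/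
def generatingCofibrations (L : SSet.{u} ⥤ C) : MorphismProperty C :=
  .ofHoms fun n : ℕ => (SSet.sd ⋙ SSet.sd ⋙ L).map (SSet.boundary.{u} n).ι

/-- If `L` is left adjoint to the nerve `N`, the cofibrations are those cofibrantly generated by the
morphisms `L Sd² (∂Δ[n] ⟶ Δ[n])`. -/
theorem cofibrations_eq_llp_rlp {L : SSet.{u} ⥤ C} {N : C ⥤ SSet.{u}} (adj : L ⊣ N) :
    cofibrations N = (generatingCofibrations L).rlp.llp := by
  have h : trivialFibrations N = (generatingCofibrations L).rlp := by
    let adj' : SSet.sd.{u} ⋙ SSet.sd.{u} ⋙ L ⊣ (N ⋙ SSet.ex) ⋙ SSet.ex :=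
      SSet.sdExAdjunction.comp (SSet.sdExAdjunction.comp adj)
    ext X Y f
    constructor
    · rintro hf _ _ _ ⟨n⟩
      exact (adj'.hasLiftingProperty_iff _ _).2 (hf _ (SSet.modelCategoryQuillen.boundary_ι_mem_I n))
    · rintro hf _ _ _ ⟨n⟩
      exact (adj'.hasLiftingProperty_iff _ _).1 (hf _ ⟨n⟩)
  rw [cofibrations, h]

end Transfer

/-! ### Acyclic categories -/

/-- A small category is acyclic if only identities are invertible and every endomorphism is an
identity. -/
structure IsAcyclic (C : Cat.{u, u}) : Prop where
  eq_of_isIso : ∀ ⦃x y : C⦄ (f : x ⟶ y), IsIso f → x = y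
  eq_id : ∀ ⦃x : C⦄ (f : x ⟶ x), f = 𝟙 x

/-- The category of small acyclic categories, a full subcategory of `Cat`. -/
abbrev Ac : Type (u + 1) := ObjectProperty.FullSubcategory (C := Cat.{u, u}) IsAcyclic

/-- The inclusion of small acyclic categories into small categories. -/
abbrev acToCat : Ac.{u} ⥤ Cat.{u, u} := ObjectProperty.ι _

/-- A poset as a small category, with one arrow `x ⟶ y` if `x ≤ y`, and none otherwise. -/
def posToCat : PartOrd.{u} ⥤ Cat.{u, u} := forget₂ PartOrd Preord ⋙ preordToCat

theorem isAcyclic_posToCat (P : PartOrd.{u}) : IsAcyclic (posToCat.obj P) where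
  eq_of_isIso _ _ f _ :=
    le_antisymm (α := P) (leOfHom (X := P) f)
      (leOfHom (X := P) (inv (C := posToCat.obj P) f))
  eq_id _ _ := Subsingleton.elim (α := ULift (PLift _)) _ _

/-- A poset as a small acyclic category. -/
def posToAc : PartOrd.{u} ⥤ Ac.{u} := ObjectProperty.lift _ posToCat isAcyclic_posToCat

/-! ### The three Thomason model structures: cofibrations and initial objects -/

instance : CategoryWithCofibrations PartOrd.{u} where
  cofibrations := cofibrations (posToCat ⋙ nerveFunctor)

instance : CategoryWithCofibrations Ac.{u} where
  cofibrations := cofibrations (acToCat ⋙ nerveFunctor)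

instance : CategoryWithCofibrations Cat.{u, u} where
  cofibrations := cofibrations nerveFunctor

instance : HasInitial PartOrd.{u} :=
  IsInitial.hasInitial (X := PartOrd.of PEmpty.{u + 1}) <|
    IsInitial.ofUniqueHom (fun P => PartOrd.ofHom ⟨PEmpty.elim, fun x => x.elim⟩)
      (fun P f => by ext x; exact x.elim)

instance : HasInitial Ac.{u} :=
  IsInitial.hasInitial (X := posToAc.obj (PartOrd.of PEmpty.{u + 1})) <|
    IsInitial.ofUniqueHom
      (fun C => ObjectProperty.homMk (Functor.toCatHom
        { obj := fun x : PEmpty => x.elim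
          map := fun {x} => x.elim
          map_id := fun x => x.elim
          map_comp := fun {x} => x.elim }))
      (fun C f => by
        apply ObjectProperty.hom_ext
        apply Cat.Hom.ext
        exact CategoryTheory.Functor.ext (fun x => PEmpty.elim x) (fun x => PEmpty.elim x))

/-- The morphism `1 ⟶ P` of posets with value `m`. -/
def pointInclusion {P : Type u} [PartialOrder P] (m : P) :
    PartOrd.of PUnit.{u + 1} ⟶ PartOrd.of P :=
  PartOrd.ofHom (OrderHom.const _ m)

end Thomason

/-! The inclusions of posets and acyclic categories into `Cat` are fully faithful, so lifting in
`Cat` suffices. Trivial fibrations are stable under pullback, so the point inclusions reduce to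
finding, for every trivial fibration `f : X ⟶ P` of categories, a section with prescribed value over
`m` (`cofibrations_of_sections`). Cofibrancy follows because trivial fibrations over a poset are
surjective on objects.

Sections are built by induction on the number of elements. Remove some `x ≠ m` and take a section
over the rest. It is kept on the elements that are not above `x` and rebuilt on those that are,
together with morphisms from the old values to the new ones (`exists_section_of_compl`). Since `x`
is not below `m`, the value at `m` survives.

The new values come from one supply of cofibrations. Maps `N (Ch Q) ⟶ Z` correspond to maps `N Q ⟶
Ex Z`, so an injection `F ⟶ Q` of posets induces a cofibration `Ch² F ⟶ Ch² Q`. If `B` is a suitable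
retract of `Ch² F`, and `Q` has a chain `v` strictly larger than the image of every chain of `F`,
then a shifted copy of `B` and a new bottom element can be read off in `Ch² Q` (`exists_cell_lift`).
This applies to `P_{>x}` or `P_{≥x}` when `P_{>x}` is a forest or has all nonempty joins.

The bound five enters only here: `P_{>x}` misses both `x` and `m`, so it has at most three elements,
and a poset of that size which is not a forest consists of two incomparable elements below a third,
hence has joins. -/

namespace Thomason

open PartialOrder

/-! ### Subdivision of nerves of posets by chains -/

section Subdivision

open Opposite Simplicial

/-- The functor sending a poset to its poset of nonempty finite chains. -/
noncomputable abbrev ch : PartOrd.{u} ⥤ PartOrd.{u} := PartOrd.nonemptyFiniteChainsFunctor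

/-- An `n`-simplex of the nerve of a poset, as a morphism of posets. -/
def simplexHom {Q : PartOrd.{u}} {n : SimplexCategoryᵒᵖ} (σ : (PartOrd.nerveFunctor.obj Q).obj n) :
    SimplexCategory.toPartOrd.{u}.obj n.unop ⟶ Q :=
  PartOrd.ofHom ⟨fun i => σ.obj i.down, fun _ _ h => σ.monotone h⟩

/-- A morphism of posets from a finite ordinal, as a simplex of the nerve. -/
def homSimplex {Q : PartOrd.{u}} {n : SimplexCategoryᵒᵖ}
    (s : SimplexCategory.toPartOrd.{u}.obj n.unop ⟶ Q) : (PartOrd.nerveFunctor.obj Q).obj n :=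
  Monotone.functor (f := fun i => s.hom (ULift.up i)) (fun _ _ h => s.hom.monotone h)

lemma nerve_ext {Q : PartOrd.{u}} {n : SimplexCategoryᵒᵖ}
    {σ τ : (PartOrd.nerveFunctor.obj Q).obj n} (h : simplexHom σ = simplexHom τ) : σ = τ :=
  nerve.ext_of_isThin (funext fun i => by
    exact congrArg (fun s => PartOrd.Hom.hom s (ULift.up i)) h)

lemma homSimplex_simplexHom {Q : PartOrd.{u}} {n : SimplexCategoryᵒᵖ}
    (σ : (PartOrd.nerveFunctor.obj Q).obj n) : homSimplex (simplexHom σ) = σ :=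
  nerve_ext rfl

/-- The map `N Q ⟶ Ex (N (Ch Q))` sending a simplex to the induced map on chains. -/
noncomputable def chainsUnit (Q : PartOrd.{u}) :
    PartOrd.nerveFunctor.obj Q ⟶ SSet.ex.obj (PartOrd.nerveFunctor.obj (ch.obj Q)) where
  app n := ↾fun σ => ULift.up (PartOrd.nerveFunctor.map (ch.map (simplexHom σ)))
  naturality n m f := by
    ext σ
    refine congrArg ULift.up ?_
    change PartOrd.nerveFunctor.map (ch.map (SimplexCategory.toPartOrd.map f.unop ≫ simplexHom σ)) = _
    rw [Functor.map_comp, Functor.map_comp]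
    rfl

/-- The simplices of `Ex Z`. -/
def exHom {Z : SSet.{u}} {n : SimplexCategoryᵒᵖ} (z : (SSet.ex.obj Z).obj n) :
    PartOrd.nerveFunctor.obj (ch.obj (SimplexCategory.toPartOrd.{u}.obj n.unop)) ⟶ Z :=
  z.down

lemma exHom_ext {Z : SSet.{u}} {n : SimplexCategoryᵒᵖ} {z z' : (SSet.ex.obj Z).obj n}
    (h : exHom z = exHom z') : z = z' := ULift.ext _ _ h

lemma chainsUnit_naturality {Q Q' : PartOrd.{u}} (g : Q ⟶ Q') :
    PartOrd.nerveFunctor.map g ≫ chainsUnit Q' =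
      chainsUnit Q ≫ SSet.ex.map (PartOrd.nerveFunctor.map (ch.map g)) := by
  ext n σ
  apply exHom_ext
  change PartOrd.nerveFunctor.map (ch.map (simplexHom σ ≫ g)) =
    PartOrd.nerveFunctor.map (ch.map (simplexHom σ)) ≫ PartOrd.nerveFunctor.map (ch.map g)
  rw [Functor.map_comp, Functor.map_comp]

lemma exists_orderEmbedding_range_eq {Q : Type u} [PartialOrder Q] (S : NonemptyFiniteChains Q) :
    ∃ (m : ℕ) (e : Fin (m + 1) ↪o Q), Set.range e = S.finset := by
  classical
  let _ : LinearOrder S.finset :=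
    { (inferInstance : PartialOrder S.finset) with
      le_total := fun a b => S.comparable a b
      toDecidableLE := Classical.decRel _ }
  have : Nonempty S.finset := S.nonempty.to_subtype
  obtain ⟨m, hm⟩ := Nat.exists_eq_succ_of_ne_zero (Fintype.card_ne_zero (α := S.finset))
  let e := monoEquivOfFin S.finset hm
  refine ⟨m, e.toOrderEmbedding.trans (OrderEmbedding.subtype _), ?_⟩
  ext q
  constructor
  · rintro ⟨i, rfl⟩
    exact (e i).2
  · intro h
    exact ⟨e.symm ⟨q, h⟩, by simp⟩

lemma ch_map_injective {Q Q' : PartOrd.{u}} (g : Q ⟶ Q') (hg : Function.Injective g) :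
    Function.Injective (ch.map g) := by
  intro a b h
  apply NonemptyFiniteChains.ext
  ext q
  have : ∀ c : ch.obj Q, q ∈ c.finset ↔ g q ∈ (ch.map g c).finset := fun c => by
    refine Iff.trans ?_ (NonemptyFiniteChains.mem_map_iff c g.hom (g q)).symm
    exact ⟨fun h => ⟨q, h, rfl⟩, fun ⟨x, hx, hxq⟩ => hg hxq ▸ hx⟩
  rw [this, this, h]

lemma nerveFunctor_map_app_injective {Q Q' : PartOrd.{u}} (g : Q ⟶ Q')
    (hg : Function.Injective g) (n : SimplexCategoryᵒᵖ) :
    Function.Injective ((PartOrd.nerveFunctor.map g).app n) := by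
  intro σ τ h
  apply nerve_ext
  ext i
  apply hg
  exact congrArg (fun s => simplexHom s i) h

lemma nerveFunctor_map_mono {Q Q' : PartOrd.{u}} (g : Q ⟶ Q') (hg : Function.Injective g) :
    Mono (PartOrd.nerveFunctor.map g) := by
  rw [NatTrans.mono_iff_mono_app]
  intro n
  rw [CategoryTheory.mono_iff_injective]
  exact nerveFunctor_map_app_injective g hg n

/-- Every simplex of the nerve of the poset of chains is the image of a simplex under the map
induced by the inclusion of its largest vertex. -/
lemma exists_simplex {Q : PartOrd.{u}} {n : SimplexCategoryᵒᵖ}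
    (c : (PartOrd.nerveFunctor.obj (ch.obj Q)).obj n) :
    ∃ (m : SimplexCategoryᵒᵖ) (e : SimplexCategory.toPartOrd.{u}.obj m.unop ⟶ Q)
      (τ : (PartOrd.nerveFunctor.obj (ch.obj (SimplexCategory.toPartOrd.{u}.obj m.unop))).obj n),
      (PartOrd.nerveFunctor.map (ch.map e)).app n τ = c ∧
      (∀ i j, e i ≤ e j ↔ i ≤ j) ∧
      Set.range e = (c.obj (Fin.last _) : NonemptyFiniteChains Q).finset := by
  classical
  obtain ⟨m, e, he⟩ := exists_orderEmbedding_range_eq (c.obj (Fin.last _) : NonemptyFiniteChains Q)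
  let e' : SimplexCategory.toPartOrd.{u}.obj ⦋m⦌ ⟶ Q :=
    PartOrd.ofHom ⟨fun i => e i.down, fun _ _ h => e.monotone h⟩
  have he' : Function.Injective e' := fun i j h => ULift.ext _ _ (e.injective h)
  have hsub : ∀ i, ∀ q ∈ (c.obj i : NonemptyFiniteChains Q).finset, ∃ j, e' j = q := by
    intro i q hq
    have : q ∈ (c.obj (Fin.last _) : NonemptyFiniteChains Q).finset :=
      c.monotone (Fin.le_last i) hq
    rw [← Finset.mem_coe, ← he] at this
    obtain ⟨j, rfl⟩ := this
    exact ⟨ULift.up j, rfl⟩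
  let τ : SimplexCategory.toPartOrd.{u}.obj n.unop ⟶ ch.obj (SimplexCategory.toPartOrd.{u}.obj ⦋m⦌) :=
    PartOrd.ofHom
      { toFun := fun i =>
          { finset := (c.obj i.down : NonemptyFiniteChains Q).finset.preimage e' he'.injOn
            nonempty := by
              obtain ⟨q, hq⟩ := (c.obj i.down : NonemptyFiniteChains Q).nonempty
              obtain ⟨j, rfl⟩ := hsub _ q hq
              exact ⟨j, Finset.mem_preimage.2 hq⟩
            comparable := fun a b => le_total (α := ULift (Fin (m + 1))) a.1 b.1 }
        monotone' := fun i j h q hq => by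
          simp only [Finset.mem_preimage] at hq ⊢
          exact c.monotone h hq }
  refine ⟨op ⦋m⦌, e', homSimplex τ, ?_, fun i j => e.le_iff_le, ?_⟩
  · apply nerve_ext
    ext i : 3
    apply NonemptyFiniteChains.ext
    ext q
    refine (NonemptyFiniteChains.mem_map_iff _ e'.hom q).trans ?_
    constructor
    · rintro ⟨x, hx, rfl⟩
      exact (Finset.mem_preimage (hf := he'.injOn)).1 hx
    · intro hq
      obtain ⟨j, rfl⟩ := hsub _ q hq
      exact ⟨j, (Finset.mem_preimage (hf := he'.injOn)).2 hq, rfl⟩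
  · rw [← he]
    ext q
    exact ⟨fun ⟨i, hi⟩ => ⟨i.down, hi⟩, fun ⟨i, hi⟩ => ⟨ULift.up i, hi⟩⟩

/-- Every simplex of `N (Ch Q)` comes from `N (Ch Δ)` for a finite ordinal `Δ` mapping to `Q`, and
there the map is recorded by its transpose. This is uniqueness in the adjunction between maps out of
`N (Ch Q)` and maps `N Q ⟶ Ex Z`. -/
lemma hom_ext_of_chainsUnit {Q : PartOrd.{u}} {Z : SSet.{u}}
    {g h : PartOrd.nerveFunctor.obj (ch.obj Q) ⟶ Z}
    (H : chainsUnit Q ≫ SSet.ex.map g = chainsUnit Q ≫ SSet.ex.map h) : g = h := by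
  ext n c
  obtain ⟨m, e, τ, rfl, -, -⟩ := exists_simplex c
  have := congrArg (fun k => exHom (k.app m (homSimplex e))) H
  change PartOrd.nerveFunctor.map (ch.map e) ≫ g = PartOrd.nerveFunctor.map (ch.map e) ≫ h at this
  exact congrArg (fun k => k.app n τ) this

lemma exists_toPartOrd_map_eq {n m : SimplexCategory}
    (s : SimplexCategory.toPartOrd.{u}.obj n ⟶ SimplexCategory.toPartOrd.{u}.obj m) :
    ∃ φ : n ⟶ m, SimplexCategory.toPartOrd.{u}.map φ = s :=
  ⟨SimplexCategory.Hom.mk ⟨fun i => (s.hom (ULift.up i)).down, fun _ _ h => s.hom.monotone h⟩, rfl⟩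

lemma exHom_app_comp {Q : PartOrd.{u}} {Z : SSet.{u}}
    (l : PartOrd.nerveFunctor.obj Q ⟶ SSet.ex.obj Z) {m p : SimplexCategoryᵒᵖ}
    (t : SimplexCategory.toPartOrd.{u}.obj p.unop ⟶ SimplexCategory.toPartOrd.{u}.obj m.unop)
    (s : SimplexCategory.toPartOrd.{u}.obj m.unop ⟶ Q) :
    exHom (l.app p (homSimplex (t ≫ s))) =
      PartOrd.nerveFunctor.map (ch.map t) ≫ exHom (l.app m (homSimplex s)) := by
  obtain ⟨φ, rfl⟩ := exists_toPartOrd_map_eq t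
  have := l.naturality_apply φ.op (homSimplex s)
  exact (congrArg exHom this)

/-- A simplex of `N (Ch Q)` has many presentations by an ordinal over `Q`. The embedding onto its
largest vertex is minimal among them: any other one, once restricted to its own largest vertex,
factors through it. So the value assigned by `l` does not depend on the presentation. -/
lemma exHom_app_congr {Q : PartOrd.{u}} {Z : SSet.{u}}
    (l : PartOrd.nerveFunctor.obj Q ⟶ SSet.ex.obj Z) {n m p : SimplexCategoryᵒᵖ}
    (e : SimplexCategory.toPartOrd.{u}.obj p.unop ⟶ Q) (he : ∀ i j, e i ≤ e j ↔ i ≤ j)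
    (s : SimplexCategory.toPartOrd.{u}.obj m.unop ⟶ Q)
    (ρ : (PartOrd.nerveFunctor.obj (ch.obj (SimplexCategory.toPartOrd.{u}.obj p.unop))).obj n)
    (τ : (PartOrd.nerveFunctor.obj (ch.obj (SimplexCategory.toPartOrd.{u}.obj m.unop))).obj n)
    (h : (PartOrd.nerveFunctor.map (ch.map s)).app n τ =
      (PartOrd.nerveFunctor.map (ch.map e)).app n ρ)
    (hr : Set.range e = (((PartOrd.nerveFunctor.map (ch.map s)).app n τ).obj (Fin.last _) :
      NonemptyFiniteChains Q).finset) :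
    (exHom (l.app m (homSimplex s))).app n τ = (exHom (l.app p (homSimplex e))).app n ρ := by
  obtain ⟨q, i, τ', rfl, -, hi⟩ := exists_simplex τ
  have hsub : ∀ j, ∃ k, e k = s (i j) := fun j => by
    have : s (i j) ∈ Set.range e := by
      rw [hr]
      refine (NonemptyFiniteChains.mem_map_iff _ s.hom _).2 ⟨i j, ?_, rfl⟩
      rw [← Finset.mem_coe, ← hi]
      exact ⟨j, rfl⟩
    exact this
  choose t ht using hsub
  let t' : SimplexCategory.toPartOrd.{u}.obj q.unop ⟶ SimplexCategory.toPartOrd.{u}.obj p.unop :=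
    PartOrd.ofHom ⟨t, fun a b hab => by
      exact (he _ _).1 (((ht a).le.trans (s.hom.monotone (i.hom.monotone hab))).trans (ht b).ge)⟩
  have hcomp : i ≫ s = t' ≫ e := by
    ext j
    exact (ht j).symm
  have hinj : Function.Injective e := fun a b hab =>
    le_antisymm ((he a b).1 hab.le) ((he b a).1 hab.ge)
  have hρ : (PartOrd.nerveFunctor.map (ch.map t')).app n τ' = ρ := by
    apply nerveFunctor_map_app_injective _ (ch_map_injective e hinj)
    rw [← h]
    have := congrArg (fun k => (PartOrd.nerveFunctor.map (ch.map k)).app n τ') hcomp.symm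
    dsimp only at this
    rw [Functor.map_comp, Functor.map_comp, Functor.map_comp, Functor.map_comp] at this
    exact this
  have h₁ := congrArg (fun k => k.app n τ') (exHom_app_comp l i s)
  have h₂ := congrArg (fun k => k.app n τ') (exHom_app_comp l t' e)
  rw [hcomp] at h₁
  rw [← hρ]
  exact h₁.symm.trans h₂

/-- Every map `N Q ⟶ Ex Z` is induced by a map `N (Ch Q) ⟶ Z`. -/
lemma exists_chainsUnit_comp_eq {Q : PartOrd.{u}} {Z : SSet.{u}}
    (l : PartOrd.nerveFunctor.obj Q ⟶ SSet.ex.obj Z) :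
    ∃ g : PartOrd.nerveFunctor.obj (ch.obj Q) ⟶ Z, chainsUnit Q ≫ SSet.ex.map g = l := by
  choose m e τ h₁ h₂ h₃ using fun n => @exists_simplex Q n
  have key : ∀ {n p : SimplexCategoryᵒᵖ} (s : SimplexCategory.toPartOrd.{u}.obj p.unop ⟶ Q)
      (ρ : (PartOrd.nerveFunctor.obj (ch.obj (SimplexCategory.toPartOrd.{u}.obj p.unop))).obj n)
      (c : (PartOrd.nerveFunctor.obj (ch.obj Q)).obj n)
      (_ : (PartOrd.nerveFunctor.map (ch.map s)).app n ρ = c),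
      (exHom (l.app _ (homSimplex (e n c)))).app n (τ n c) =
        (exHom (l.app p (homSimplex s))).app n ρ := by
    rintro n p s ρ c rfl
    exact (exHom_app_congr l _ (h₂ n _) s _ ρ (h₁ n _).symm (h₃ n _)).symm
  refine ⟨{ app := fun n => ↾fun c => (exHom (l.app _ (homSimplex (e n c)))).app n (τ n c)
            naturality := fun n p f => ?_ }, ?_⟩
  · ext c
    refine (key (e n c) ((PartOrd.nerveFunctor.obj _).map f (τ n c)) _ ?_).trans ?_
    · refine ((PartOrd.nerveFunctor.map (ch.map (e n c))).naturality_apply f (τ n c)).trans ?_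
      rw [h₁]
      rfl
    · exact (exHom (l.app _ (homSimplex (e n c)))).naturality_apply f (τ n c)
  · ext n σ
    apply exHom_ext
    ext p ρ
    have := key (simplexHom σ) ρ ((PartOrd.nerveFunctor.map (ch.map (simplexHom σ))).app p ρ) rfl
    rw [homSimplex_simplexHom] at this
    exact this

/-- The trivial fibrations of simplicial sets after applying `Ex²` lift against the maps
`N (Ch² F) ⟶ N (Ch² Q)` induced by injective morphisms of posets `F ⟶ Q`. -/
lemma hasLiftingProperty_nerve_ch_ch {X Y : SSet.{u}} (f : X ⟶ Y)
    (hf : SSet.modelCategoryQuillen.I.{u}.rlp (SSet.ex.map (SSet.ex.map f)))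
    {F Q : PartOrd.{u}} (i : F ⟶ Q) (hi : Function.Injective i) :
    HasLiftingProperty (PartOrd.nerveFunctor.map (ch.map (ch.map i))) f where
  sq_hasLift {α β} sq := by
    -- Two-fold transposition, from maps out of `N (Ch² P)` to maps `N P ⟶ Ex² Z`. It turns the
    -- lifting problem into one against the monomorphism `N F ⟶ N Q`.
    let lift₂ {P : PartOrd.{u}} {Z : SSet.{u}}
        (a : PartOrd.nerveFunctor.obj (ch.obj (ch.obj P)) ⟶ Z) :
        PartOrd.nerveFunctor.obj P ⟶ SSet.ex.obj (SSet.ex.obj Z) :=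
      chainsUnit P ≫ SSet.ex.map (chainsUnit (ch.obj P) ≫ SSet.ex.map a)
    have lift₂_inj {P : PartOrd.{u}} {Z : SSet.{u}}
        {a b : PartOrd.nerveFunctor.obj (ch.obj (ch.obj P)) ⟶ Z} (h : lift₂ a = lift₂ b) : a = b :=
      hom_ext_of_chainsUnit (hom_ext_of_chainsUnit h)
    have lift₂_comp {P : PartOrd.{u}} {Z Z' : SSet.{u}}
        (a : PartOrd.nerveFunctor.obj (ch.obj (ch.obj P)) ⟶ Z) (g : Z ⟶ Z') :
        lift₂ (a ≫ g) = lift₂ a ≫ SSet.ex.map (SSet.ex.map g) := by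
      simp [lift₂]
    have comp_lift₂ {Z : SSet.{u}} (a : PartOrd.nerveFunctor.obj (ch.obj (ch.obj Q)) ⟶ Z) :
        lift₂ (PartOrd.nerveFunctor.map (ch.map (ch.map i)) ≫ a) =
          PartOrd.nerveFunctor.map i ≫ lift₂ a := by
      dsimp only [lift₂]
      rw [← Category.assoc (PartOrd.nerveFunctor.map i), chainsUnit_naturality, Category.assoc,
        ← Functor.map_comp, ← Category.assoc (PartOrd.nerveFunctor.map _), chainsUnit_naturality,
        Category.assoc, ← Functor.map_comp]
    have := nerveFunctor_map_mono i hi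
    have : HasLiftingProperty (PartOrd.nerveFunctor.map i) (SSet.ex.map (SSet.ex.map f)) := by
      rw [← SSet.rlp_monomorphisms] at hf
      exact hf _ (MorphismProperty.monomorphisms.infer_property _)
    have sq' : CommSq (lift₂ α) (PartOrd.nerveFunctor.map i) (SSet.ex.map (SSet.ex.map f))
        (lift₂ β) := ⟨by rw [← lift₂_comp, sq.w, comp_lift₂]⟩
    obtain ⟨g, hg⟩ := exists_chainsUnit_comp_eq sq'.lift
    obtain ⟨h, rfl⟩ := exists_chainsUnit_comp_eq g
    change lift₂ h = _ at hg
    refine ⟨⟨h, ?_, ?_⟩⟩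
    · apply lift₂_inj
      rw [comp_lift₂, hg, sq'.fac_left]
    · apply lift₂_inj
      rw [lift₂_comp, hg, sq'.fac_right]

/-- The nerve is fully faithful, so a lift between nerves is a lift between categories. -/
lemma cofibrations_ch_ch {F Q : PartOrd.{u}} (i : F ⟶ Q) (hi : Function.Injective i) :
    cofibrations nerveFunctor.{u, u} (posToCat.map (ch.map (ch.map i))) := by
  intro X Y f hf
  have := hasLiftingProperty_nerve_ch_ch (nerveFunctor.map f) hf i hi
  constructor
  intro α β sq
  have sq' : CommSq (nerveFunctor.map α) (PartOrd.nerveFunctor.map (ch.map (ch.map i)))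
      (nerveFunctor.map f) (nerveFunctor.map β) :=
    ⟨(nerveFunctor.map_comp α f).symm.trans
      ((congrArg nerveFunctor.map sq.w).trans (nerveFunctor.map_comp _ _))⟩
  have hsq : sq'.HasLift := this.sq_hasLift sq'
  obtain ⟨γ, hγ⟩ := nerveFunctor.map_surjective
    (show nerveFunctor.obj (posToCat.obj (ch.obj (ch.obj Q))) ⟶ nerveFunctor.obj X from sq'.lift)
  refine ⟨⟨γ, nerveFunctor.map_injective ?_, nerveFunctor.map_injective ?_⟩⟩
  · rw [Functor.map_comp, hγ]
    exact sq'.fac_left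
  · rw [Functor.map_comp, hγ]
    exact sq'.fac_right

end Subdivision

/-! ### Attachable posets and extension of monotone maps -/

/-- A condition on a poset `B` ensuring that it is a retract of the poset of chains of chains of a
poset `F` which maps injectively to a poset `Q` in such a way that all the chains of `F` become
faces of a single larger chain. -/
def IsAttachable (B : Type u) [PartialOrder B] : Prop :=
  ∃ (F Q : Type u) (_ : PartialOrder F) (_ : PartialOrder Q) (i : F →o Q)
    (v : NonemptyFiniteChains Q) (D : B → NonemptyFiniteChains F)
    (μ : NonemptyFiniteChains F → B),
    Function.Injective i ∧ (∀ S : NonemptyFiniteChains F, S.map i < v) ∧ (∀ b, μ (D b) = b) ∧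
    (∀ b b₁ b₂, b₁ ≤ b → b₂ ≤ b → D b₁ ≤ D b₂ ∨ D b₂ ≤ D b₁) ∧
    ∀ z : NonemptyFiniteChains (NonemptyFiniteChains F), ∃ s, IsLUB (μ '' z.finset) s

/-- A chain of chains in `Q` has a part coming from `F`, whose labels under `μ` have a supremum in
`B`. The map `β` applies `p` to it if everything comes from `F`, applies `q` if only some members
do, and is `x` if none does. The inequalities `p ≤ q` and `x ≤ q` make this monotone. -/
lemma exists_monotone_extension {B : Type u} [PartialOrder B] [Finite B] (hB : IsAttachable B) :
    ∃ (F Q : PartOrd.{u}) (i : F ⟶ Q) (_ : Function.Injective i) (r : ch.obj (ch.obj F) →o B)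
      (k : B →o ch.obj (ch.obj F)) (j : WithBot B →o ch.obj (ch.obj Q)),
      (∀ b, r (k b) = b) ∧ (∀ b : B, ch.map (ch.map i) (k b) ≤ j b) ∧
      ∀ (P : Type u) [PartialOrder P] (p q : B →o P) (x : P), p ≤ q → (∀ b, x ≤ q b) →
        ∃ β : ch.obj (ch.obj Q) →o P, (∀ z, β (ch.map (ch.map i) z) = p (r z)) ∧ β (j ⊥) = x ∧
          ∀ b : B, β (j b) = q b := by
  classical
  obtain ⟨F, Q, _, _, i, v, D, μ, hi, hv, hμ, hD, hz⟩ := hB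
  have hmapinj : Function.Injective (fun S : NonemptyFiniteChains F => S.map i) :=
    ch_map_injective (PartOrd.ofHom i) hi
  have hmaple : ∀ S S' : NonemptyFiniteChains F, S.map i ≤ S'.map i → S ≤ S' := by
    intro S S' h x hx
    obtain ⟨y, hy, hyx⟩ := (NonemptyFiniteChains.mem_map_iff _ _ _).1
      (h ((NonemptyFiniteChains.mem_map_iff _ _ _).2 ⟨x, hx, rfl⟩))
    exact hi hyx ▸ hy
  let ii : NonemptyFiniteChains F →o NonemptyFiniteChains Q := NonemptyFiniteChains.orderHomMap i
  let T : NonemptyFiniteChains (NonemptyFiniteChains Q) → Set B :=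
    fun z => {b | ∃ S : NonemptyFiniteChains F, S.map i ∈ z.finset ∧ μ S = b}
  have hTmono : ∀ {z z'}, z ≤ z' → T z ⊆ T z' := fun h b ⟨S, hS, hb⟩ => ⟨S, h hS, hb⟩
  have hT : ∀ z, (T z).Nonempty → ∃ s, IsLUB (T z) s := by
    rintro z ⟨_, S₀, hS₀, -⟩
    obtain ⟨s, hs⟩ := hz
      { finset := z.finset.preimage _ hmapinj.injOn
        nonempty := ⟨S₀, Finset.mem_preimage.2 hS₀⟩
        comparable := fun a b =>
          (z.comparable ⟨_, Finset.mem_preimage.1 a.2⟩ ⟨_, Finset.mem_preimage.1 b.2⟩).imp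
            (hmaple _ _) (hmaple _ _) }
    refine ⟨s, ?_⟩
    convert hs using 1
    ext b
    simp [T]
  choose s hs using hT
  have hs_mono : ∀ {z z'} (h : z ≤ z') (hz : (T z).Nonempty) (hz' : (T z').Nonempty),
      s z hz ≤ s z' hz' := fun h hz hz' => isLUB_le_iff (hs _ hz) |>.2 fun b hb =>
        (hs _ hz').1 (hTmono h hb)
  have hTimg : ∀ z : NonemptyFiniteChains (NonemptyFiniteChains F), (T (z.map ii)).Nonempty := by
    intro z
    obtain ⟨S, hS⟩ := z.nonempty
    exact ⟨μ S, S, (NonemptyFiniteChains.mem_map_iff _ _ _).2 ⟨S, hS, rfl⟩, rfl⟩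
  have hmapmono : ∀ {z z' : NonemptyFiniteChains (NonemptyFiniteChains F)}, z ≤ z' →
      z.map ii ≤ z'.map ii := fun h => (NonemptyFiniteChains.orderHomMap ii).monotone h
  -- The labels of this chain form exactly `Set.Iic b`, whose supremum is `b`; hence `r ∘ k` is the
  -- identity.
  let kfin : B → Finset (NonemptyFiniteChains F) := fun b =>
    (Set.toFinite (Set.Iic b)).toFinset.image D
  have hkfin : ∀ b S, S ∈ kfin b ↔ ∃ b' ≤ b, D b' = S := fun b S => by simp [kfin]
  let k : B →o NonemptyFiniteChains (NonemptyFiniteChains F) :=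
    { toFun := fun b =>
        { finset := kfin b
          nonempty := ⟨D b, (hkfin _ _).2 ⟨b, le_rfl, rfl⟩⟩
          comparable := by
            rintro ⟨_, h₁⟩ ⟨_, h₂⟩
            obtain ⟨b₁, hb₁, rfl⟩ := (hkfin _ _).1 h₁
            obtain ⟨b₂, hb₂, rfl⟩ := (hkfin _ _).1 h₂
            exact hD b b₁ b₂ hb₁ hb₂ }
      monotone' := fun b b' h S hS => by
        obtain ⟨c, hc, rfl⟩ := (hkfin _ _).1 hS
        exact (hkfin _ _).2 ⟨c, hc.trans h, rfl⟩ }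
  have hTk : ∀ (z : NonemptyFiniteChains (NonemptyFiniteChains Q)) (b : B),
      (∀ S : NonemptyFiniteChains F, S.map i ∈ z.finset ↔ S ∈ (k b).finset) → T z = Set.Iic b := by
    intro z b h
    ext c
    constructor
    · rintro ⟨S, hS, rfl⟩
      obtain ⟨b', hb', rfl⟩ := (hkfin _ _).1 ((h S).1 hS)
      rwa [hμ]
    · intro hc
      exact ⟨D c, (h _).2 ((hkfin _ _).2 ⟨c, hc, rfl⟩), hμ c⟩
  have hsk : ∀ z b (hz : (T z).Nonempty), T z = Set.Iic b → s z hz = b := fun z b hz h =>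
    (hs z hz).unique (h ▸ isLUB_Iic)
  have hmap : ∀ (z : NonemptyFiniteChains (NonemptyFiniteChains F)) (S : NonemptyFiniteChains F),
      S.map i ∈ (z.map ii).finset ↔ S ∈ z.finset := fun z S =>
    (NonemptyFiniteChains.mem_map_iff _ _ _).trans
      ⟨fun ⟨S', hS', h⟩ => hmapinj h ▸ hS', fun h => ⟨S, h, rfl⟩⟩
  have hmap' : ∀ (z : NonemptyFiniteChains (NonemptyFiniteChains F)), ∀ S ∈ (z.map ii).finset,
      ∃ S' : NonemptyFiniteChains F, S'.map i = S := fun z S hS => by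
    obtain ⟨S', -, rfl⟩ := (NonemptyFiniteChains.mem_map_iff _ _ _).1 hS
    exact ⟨S', rfl⟩
  have hmaplt : ∀ (z : NonemptyFiniteChains (NonemptyFiniteChains F)), ∀ S ∈ (z.map ii).finset,
      S < v := fun z S hS => by
    obtain ⟨S', rfl⟩ := hmap' z S hS
    exact hv S'
  -- Adding `v` on top leaves the labels unchanged but leaves the image of `Ch² F`, which switches
  -- `p` to `q`. The bottom element goes to `{v}`, which has no labels.
  let jfin : WithBot B → Finset (NonemptyFiniteChains Q) := fun o =>
    insert v (o.recBotCoe ∅ fun b => ((k b).map ii).finset)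
  have hjfin : ∀ o S, S ∈ jfin o ↔ S = v ∨ ∃ b : B, o = b ∧ S ∈ ((k b).map ii).finset := by
    intro o S
    induction o with
    | bot => simp [jfin]
    | coe b => simp [jfin]
  let j : WithBot B →o NonemptyFiniteChains (NonemptyFiniteChains Q) :=
    { toFun := fun o =>
        { finset := jfin o
          nonempty := ⟨v, (hjfin _ _).2 (Or.inl rfl)⟩
          comparable := by
            rintro ⟨S, h₁⟩ ⟨S', h₂⟩
            change S ≤ S' ∨ S' ≤ S
            obtain h₁ | ⟨b₁, hb₁, h₁⟩ := (hjfin _ _).1 h₁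
            · obtain h₂ | ⟨b₂, hb₂, h₂⟩ := (hjfin _ _).1 h₂
              · exact Or.inl (h₁.trans h₂.symm).le
              · exact Or.inr (h₁ ▸ (hmaplt _ _ h₂).le)
            · obtain h₂ | ⟨b₂, hb₂, h₂⟩ := (hjfin _ _).1 h₂
              · exact Or.inl (h₂ ▸ (hmaplt _ _ h₁).le)
              · obtain rfl : b₁ = b₂ := WithBot.coe_injective (hb₁.symm.trans hb₂)
                exact ((k b₁).map ii).comparable ⟨S, h₁⟩ ⟨S', h₂⟩ }
      monotone' := fun o o' h S hS => by
        obtain rfl | ⟨b, rfl, hb⟩ := (hjfin _ _).1 hS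
        · exact (hjfin _ _).2 (Or.inl rfl)
        · obtain ⟨b', rfl, hb'⟩ := WithBot.coe_le_iff.1 h
          exact (hjfin _ _).2 (Or.inr ⟨b', rfl, hmapmono (k.monotone hb') hb⟩) }
  have hj : ∀ (b : B) (S : NonemptyFiniteChains F),
      S.map i ∈ (j b).finset ↔ S ∈ (k b).finset := fun b S => by
    refine (hjfin _ _).trans ?_
    rw [← hmap]
    constructor
    · rintro (h | ⟨b', hb', h⟩)
      · exact absurd h (hv S).ne
      · rwa [WithBot.coe_injective hb']
    · exact fun h => Or.inr ⟨b, rfl, h⟩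
  refine ⟨PartOrd.of F, PartOrd.of Q, PartOrd.ofHom i, hi,
    ⟨fun z => s (z.map ii) (hTimg z), fun z z' h => hs_mono (hmapmono h) _ _⟩, k, j, ?_, ?_, ?_⟩
  · exact fun b => hsk _ b _ (hTk _ b (hmap _))
  · exact fun b => Finset.subset_insert v _
  · intro P _ p q x hpq hxq
    let R : Set (NonemptyFiniteChains (NonemptyFiniteChains Q)) :=
      {z | ∀ S ∈ z.finset, ∃ S' : NonemptyFiniteChains F, S'.map i = S}
    have hjR : ∀ o, j o ∉ R := fun o hR => by
      obtain ⟨S, hS⟩ := hR v (Finset.mem_insert_self _ _)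
      exact (hv S).ne hS
    let β : NonemptyFiniteChains (NonemptyFiniteChains Q) → P := fun z =>
      if h : (T z).Nonempty then (if z ∈ R then p (s z h) else q (s z h)) else x
    have hβ₁ : ∀ z (h : (T z).Nonempty), z ∈ R → β z = p (s z h) := fun z h hR => by
      simp only [β, dif_pos h, if_pos hR]
    have hβ₂ : ∀ z (h : (T z).Nonempty), z ∉ R → β z = q (s z h) := fun z h hR => by
      simp only [β, dif_pos h, if_neg hR]
    have hβ₃ : ∀ z, ¬ (T z).Nonempty → β z = x := fun z h => by
      simp only [β, dif_neg h]
    refine ⟨⟨β, ?_⟩, ?_, ?_, ?_⟩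
    · intro z z' h
      by_cases hz' : (T z').Nonempty
      · by_cases hz : (T z).Nonempty
        · have := hs_mono h hz hz'
          by_cases hR' : z' ∈ R
          · have hR : z ∈ R := fun S hS => hR' S (h hS)
            rw [hβ₁ _ hz hR, hβ₁ _ hz' hR']
            exact p.monotone this
          · rw [hβ₂ _ hz' hR']
            by_cases hR : z ∈ R
            · rw [hβ₁ _ hz hR]
              exact (hpq _).trans (q.monotone this)
            · rw [hβ₂ _ hz hR]
              exact q.monotone this
        · have hR' : z' ∉ R := fun hR' => by
            obtain ⟨S, hS⟩ := z.nonempty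
            obtain ⟨S', rfl⟩ := hR' S (h hS)
            exact hz ⟨_, S', hS, rfl⟩
          rw [hβ₃ _ hz, hβ₂ _ hz' hR']
          exact hxq _
      · rw [hβ₃ _ hz', hβ₃ _ fun hz => hz' (hz.mono (hTmono h))]
    · exact fun z => hβ₁ _ (hTimg z) (hmap' z)
    · refine hβ₃ _ ?_
      rintro ⟨_, S, hS, -⟩
      obtain h | ⟨b, hb, -⟩ := (hjfin _ _).1 hS
      · exact (hv S).ne h
      · exact WithBot.bot_ne_coe hb
    · intro b
      have hT : T (j b) = Set.Iic b := hTk _ b (hj b)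
      have hne : (T (j b)).Nonempty := ⟨b, hT ▸ le_refl b⟩
      exact (hβ₂ _ hne (hjR _)).trans (congrArg q (hsk _ _ hne hT))

/-! ### Lifting a cell and gluing it to a section -/

lemma functor_ext_of_obj {C : Type*} [Category* C] {P : Type*} [PartialOrder P] {F G : C ⥤ P}
    (h : ∀ c, F.obj c = G.obj c) : F = G :=
  CategoryTheory.Functor.ext h fun _ _ _ => Subsingleton.elim _ _

/-- The natural transformation between functors to a poset given by inequalities. -/
def natTransOfLE {C : Type*} [Category* C] {P : Type*} [PartialOrder P] {F G : C ⥤ P}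
    (h : ∀ c, F.obj c ≤ G.obj c) : F ⟶ G where
  app c := homOfLE (h c)

/-- Given a trivial fibration over a poset `P`, a lift of a map `p : B → P` extends along the
attachment of a copy of `B` lying over a larger map `q : B → P` and of a new least element below
that copy. -/
lemma exists_cell_lift {B : Type u} [PartialOrder B] [Finite B] (hB : IsAttachable B)
    {X : Cat.{u, u}} {P : Type u} [PartialOrder P] (f : X ⟶ posToCat.obj (PartOrd.of P))
    (hf : trivialFibrations nerveFunctor.{u, u} f) (p q : B →o P) (x : P) (hpq : p ≤ q)
    (hxq : ∀ b, x ≤ q b) (α : B ⥤ X) (hα : ∀ b, f.toFunctor.obj (α.obj b) = p b) :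
    ∃ γ : WithBot B ⥤ X, f.toFunctor.obj (γ.obj ⊥) = x ∧
      (∀ b : B, f.toFunctor.obj (γ.obj b) = q b) ∧
      Nonempty (α ⟶ WithBot.coe_mono.functor ⋙ γ) := by
  obtain ⟨F, Q, i, hi, r, k, j, hrk, hkj, h⟩ := exists_monotone_extension hB
  obtain ⟨β, hβ₁, hβ₂, hβ₃⟩ := h P p q x hpq hxq
  let α' : posToCat.obj (ch.obj (ch.obj F)) ⟶ X := (r.monotone.functor ⋙ α).toCatHom
  let β' : posToCat.obj (ch.obj (ch.obj Q)) ⟶ posToCat.obj (PartOrd.of P) :=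
    posToCat.map (PartOrd.ofHom β)
  have sq : CommSq α' (posToCat.map (ch.map (ch.map i))) f β' := ⟨by
    apply Cat.Hom.ext
    refine functor_ext_of_obj (P := P) fun z => ?_
    exact (hα (r z)).trans (hβ₁ z).symm⟩
  have : HasLiftingProperty (posToCat.map (ch.map (ch.map i))) f := cofibrations_ch_ch i hi _ hf
  let l : ch.obj (ch.obj Q) ⥤ X := sq.lift.toFunctor
  let i' : ch.obj (ch.obj F) ⥤ ch.obj (ch.obj Q) := (ch.map (ch.map i)).hom.monotone.functor
  have hl₁ : i' ⋙ l = r.monotone.functor ⋙ α := congrArg Cat.Hom.toFunctor sq.fac_left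
  have hl₂ : ∀ z, f.toFunctor.obj (l.obj z) = β z := fun z =>
    congrArg (fun g => g.toFunctor.obj z) sq.fac_right
  have hα' : α = (k.monotone.functor ⋙ i') ⋙ l := by
    rw [Functor.assoc, hl₁, ← Functor.assoc,
      functor_ext_of_obj (F := k.monotone.functor ⋙ r.monotone.functor) (G := 𝟭 B) hrk,
      Functor.id_comp]
  refine ⟨j.monotone.functor ⋙ l, (hl₂ _).trans hβ₂, fun b => (hl₂ _).trans (hβ₃ b), ⟨?_⟩⟩
  exact eqToHom hα' ≫ Functor.whiskerRight
    (natTransOfLE (G := WithBot.coe_mono.functor ⋙ j.monotone.functor) hkj) l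

/-- Functors on a lower set of a poset and on its complementary upper set, together with a
compatible family of morphisms from the former to the latter, define a functor on the poset. -/
lemma exists_functor_glue {X : Type*} [Category* X] {P : Type*} [PartialOrder P] (x : P)
    (α : {p : P // ¬ x ≤ p} ⥤ X) (γ : {p : P // x ≤ p} ⥤ X)
    (θ : ∀ p v, p.1 ≤ v.1 → (α.obj p ⟶ γ.obj v))
    (hα : ∀ p p' v (h : p ≤ p') (h' : p'.1 ≤ v.1),
      α.map (homOfLE h) ≫ θ p' v h' = θ p v (le_trans h h'))
    (hγ : ∀ p v v' (h : p.1 ≤ v.1) (h' : v ≤ v'),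
      θ p v h ≫ γ.map (homOfLE h') = θ p v' (h.trans h')) :
    ∃ F : P ⥤ X, (∀ p (hp : ¬ x ≤ p), F.obj p = α.obj ⟨p, hp⟩) ∧
      ∀ p (hp : x ≤ p), F.obj p = γ.obj ⟨p, hp⟩ := by
  classical
  let W := {p : P // ¬ x ≤ p} ⊕ {p : P // x ≤ p}
  let val : W → P := Sum.elim Subtype.val Subtype.val
  let obj : W → X := Sum.elim α.obj γ.obj
  let map : ∀ a b : W, val a ≤ val b → (obj a ⟶ obj b)
    | .inl p, .inl p', h => α.map (homOfLE h)
    | .inl p, .inr v, h => θ p v h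
    | .inr v, .inl p, h => (p.2 (v.2.trans h)).elim
    | .inr v, .inr v', h => γ.map (homOfLE h)
  have map_id : ∀ a, map a a le_rfl = 𝟙 _
    | .inl p => α.map_id p
    | .inr v => γ.map_id v
  have map_comp : ∀ a b c (h : val a ≤ val b) (h' : val b ≤ val c),
      map a c (h.trans h') = map a b h ≫ map b c h'
    | .inl p, .inl p', .inl p'', h, h' => α.map_comp (homOfLE h) (homOfLE h')
    | .inl p, .inl p', .inr v, h, h' => (hα p p' v h h').symm
    | .inl p, .inr v, .inl p', h, h' => (p'.2 (v.2.trans h')).elim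
    | .inl p, .inr v, .inr v', h, h' => (hγ p v v' h h').symm
    | .inr v, .inl p, _, h, _ => (p.2 (v.2.trans h)).elim
    | .inr v, .inr v', .inl p, _, h' => (p.2 (v'.2.trans h')).elim
    | .inr v, .inr v', .inr v'', h, h' => γ.map_comp (homOfLE h) (homOfLE h')
  let s : P → W := fun p => if h : x ≤ p then .inr ⟨p, h⟩ else .inl ⟨p, h⟩
  have hs : ∀ p, val (s p) = p := fun p => by
    by_cases h : x ≤ p <;> simp [s, h, val]
  have hle : ∀ {p p'}, p ≤ p' → val (s p) ≤ val (s p') := fun h => by rwa [hs, hs]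
  refine ⟨{ obj := fun p => obj (s p)
            map := fun f => map _ _ (hle (leOfHom f))
            map_id := fun p => map_id _
            map_comp := fun f g => map_comp _ _ _ _ _ }, fun p hp => ?_, fun p hp => ?_⟩
  · simp [s, hp, obj]
  · simp [s, hp, obj]

/-- Extension of sections of trivial fibrations over a poset from the complement of an element
`x` to the whole poset. -/
lemma exists_section_of_compl {P : Type u} [PartialOrder P] (x : P)
    {B : Type u} [PartialOrder B] [Finite B] (hB : IsAttachable B)
    (k : {p : P // x ≤ p} →o WithBot B) (w : B →o {p : P // p ≠ x}) (q : B →o P)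
    (hwq : ∀ b, (w b : P) ≤ q b) (hxq : ∀ b, x ≤ q b)
    (hk₁ : ∀ v, k v = ⊥ → (v : P) = x) (hk₂ : ∀ v (b : B), k v = b → v = q b)
    (hcov : ∀ p (v : {p : P // x ≤ p}), ¬ x ≤ p → p ≤ v → ∃ b : B, k v = b ∧ p ≤ w b)
    {X : Cat.{u, u}} (f : X ⟶ posToCat.obj (PartOrd.of P))
    (hf : trivialFibrations nerveFunctor.{u, u} f)
    (α : {p : P // p ≠ x} ⥤ X) (hα : ∀ p, f.toFunctor.obj (α.obj p) = p.1) :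
    ∃ F : P ⥤ X, (∀ p, f.toFunctor.obj (F.obj p) = p) ∧
      ∀ p (hp : p ≠ x), ¬ x ≤ p → F.obj p = α.obj ⟨p, hp⟩ := by
  obtain ⟨γ, hγ₁, hγ₂, ⟨τ⟩⟩ := exists_cell_lift hB f hf
    ((⟨Subtype.val, fun _ _ h => h⟩ : {p : P // p ≠ x} →o P).comp w) q x hwq hxq
    (w.monotone.functor ⋙ α) (fun b => hα _)
  let A := {p : P // ¬ x ≤ p}
  let ι : A →o {p : P // p ≠ x} := ⟨fun p => ⟨p.1, fun h => p.2 h.ge⟩, fun _ _ h => h⟩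
  obtain ⟨t, ht⟩ : ∃ t : ∀ b : B, α.obj (w b) ⟶ γ.obj (b : WithBot B), ∀ (b b' : B) (h : b ≤ b'),
      α.map (homOfLE (w.monotone h)) ≫ t b' = t b ≫ γ.map (homOfLE (WithBot.coe_le_coe.2 h)) :=
    ⟨fun b => τ.app b, fun b b' h => τ.naturality (homOfLE h)⟩
  have hα_comp : ∀ {a b c} (h : a ≤ b) (h' : b ≤ c),
      α.map (homOfLE h) ≫ α.map (homOfLE h') = α.map (homOfLE (h.trans h')) :=
    fun h h' => (α.map_comp _ _).symm
  have hγ_comp : ∀ {a b c} (h : a ≤ b) (h' : b ≤ c),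
      γ.map (homOfLE h) ≫ γ.map (homOfLE h') = γ.map (homOfLE (h.trans h')) :=
    fun h h' => (γ.map_comp _ _).symm
  -- Morphisms from old to new values pass through some `w b`. By naturality of `t`, enlarging `b`
  -- does not change the composite, which gives both compatibilities needed for gluing.
  let θ₀ : ∀ (p : A) (b : B) (o : WithBot B), (p : P) ≤ w b → (b : WithBot B) ≤ o →
      (α.obj (ι p) ⟶ γ.obj o) := fun p b o h h' =>
    α.map (homOfLE (x := ι p) (y := w b) h) ≫ t b ≫ γ.map (homOfLE h')
  have hθ₀ : ∀ p b b' o h h' h'' h''', b ≤ b' → θ₀ p b o h h' = θ₀ p b' o h'' h''' := by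
    intro p b b' o h h' h'' h''' hbb'
    dsimp only [θ₀]
    rw [← hα_comp (a := ι p) h (w.monotone hbb'), ← hγ_comp (WithBot.coe_le_coe.2 hbb') h''',
      Category.assoc, ← Category.assoc (t b), ← ht b b' hbb', Category.assoc]
  choose c hc₁ hc₂ using fun (p : A) v => hcov p.1 v p.2
  obtain ⟨F, hF₁, hF₂⟩ := exists_functor_glue x (ι.monotone.functor ⋙ α) (k.monotone.functor ⋙ γ)
    (fun p v h => θ₀ p (c p v h) (k v) (hc₂ p v h) (hc₁ p v h).ge)
    (fun p p' v h h' => by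
      have e : c p v (le_trans h h') = c p' v h' :=
        WithBot.coe_injective ((hc₁ _ _ _).symm.trans (hc₁ _ _ _))
      refine Eq.trans ?_ (hθ₀ p (c p' v h') _ _ (le_trans h (hc₂ _ _ _)) (hc₁ _ _ _).ge _ _ e.ge)
      refine (Category.assoc _ _ _).symm.trans ?_
      exact congrArg (· ≫ _) (hα_comp (a := ι p) (b := ι p') h (hc₂ p' v h')))
    (fun p v v' h h' => by
      have e : c p v h ≤ c p v' (h.trans h') :=
        WithBot.coe_le_coe.1 ((hc₁ _ _ _).symm.trans_le ((k.monotone h').trans (hc₁ _ _ _).le))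
      refine Eq.trans ?_ (hθ₀ p (c p v h) _ (k v') (hc₂ _ _ _)
        ((hc₁ _ _ _).ge.trans (k.monotone h')) _ _ e)
      refine (Category.assoc _ _ _).trans (congrArg (_ ≫ ·) ?_)
      exact (Category.assoc _ _ _).trans (congrArg (_ ≫ ·) (hγ_comp _ (k.monotone h'))))
  refine ⟨F, fun p => ?_, fun p hp hxp => hF₁ p hxp⟩
  by_cases hp : x ≤ p
  · rw [hF₂ p hp]
    change f.toFunctor.obj (γ.obj (k ⟨p, hp⟩)) = p
    cases h : k ⟨p, hp⟩ with
    | bot => rw [hγ₁]; exact (hk₁ _ h).symm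
    | coe b => rw [hγ₂]; exact (hk₂ _ _ h).symm
  · rw [hF₁ p hp]
    exact hα _

/-! ### Forests and posets with joins are attachable -/

lemma exists_isGreatest {F : Type u} [PartialOrder F] (S : NonemptyFiniteChains F) :
    ∃ g, IsGreatest (S.finset : Set F) g := by
  obtain ⟨m, e, he⟩ := exists_orderEmbedding_range_eq S
  rw [← he]
  exact ⟨e (Fin.last m), ⟨_, rfl⟩, fun _ ⟨i, hi⟩ => hi ▸ e.monotone (Fin.le_last i)⟩

/-- A poset `B` is attachable if its underlying set carries a forest order in which elements with a
common upper bound in `B` are comparable, and whose finite chains have least upper bounds in `B`. -/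
lemma isAttachable_of_forest {B F : Type u} [PartialOrder B] [PartialOrder F] [Finite F]
    (e : B ≃ F) (hF : ∀ a b c : F, a ≤ c → b ≤ c → a ≤ b ∨ b ≤ a)
    (hB : ∀ a b c : B, a ≤ c → b ≤ c → e a ≤ e b ∨ e b ≤ e a)
    (hlub : ∀ S : NonemptyFiniteChains F, ∃ s, IsLUB (e.symm '' S.finset) s) :
    IsAttachable B := by
  classical
  choose g hg using fun S : NonemptyFiniteChains F => exists_isGreatest S
  let D : F → NonemptyFiniteChains F := fun b =>
    { finset := (Set.toFinite (Set.Iic b)).toFinset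
      nonempty := ⟨b, by simp⟩
      comparable := fun x y => hF x y b (Set.mem_Iic.1 ((Set.Finite.mem_toFinset _).1 x.2))
        (Set.mem_Iic.1 ((Set.Finite.mem_toFinset _).1 y.2)) }
  have hD : ∀ b c, c ∈ (D b).finset ↔ c ≤ b := fun b c => by simp [D]
  have hDmono : ∀ {b c}, b ≤ c → D b ≤ D c := fun h a ha =>
    (hD _ _).2 (((hD _ _).1 ha).trans h)
  have hv : ∀ S : NonemptyFiniteChains F,
      ⊤ ∉ (S.map (⟨fun a => WithTop.some (toLinearExtension a),
        fun _ _ h => WithTop.coe_le_coe.2 (toLinearExtension.monotone h)⟩ :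
          F →o WithTop (LinearExtension F))).finset := fun S h => by
    obtain ⟨x, -, hx⟩ := (NonemptyFiniteChains.mem_map_iff _ _ _).1 h
    exact WithTop.coe_ne_top hx
  have : Finite (LinearExtension F) := ‹Finite F›
  -- Here `Q` is a linear extension of `F` with a new top and `v` is all of `Q`; the new top makes
  -- `v` strictly larger than every chain from `F`. The label of a chain is its greatest element,
  -- and `D` sends `b` to the principal lower set of `e b`.
  refine ⟨F, WithTop (LinearExtension F), inferInstance, inferInstance, _,
    { finset := (Set.toFinite Set.univ).toFinset
      nonempty := ⟨⊤, by simp⟩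
      comparable := fun a b => le_total _ _ },
    fun b => D (e b), fun S => e.symm (g S), fun a b h => WithTop.coe_injective h,
    fun S => lt_of_le_of_ne (fun x _ => by simp) fun h => hv S (by rw [h]; simp), fun b => ?_,
    fun b b₁ b₂ h₁ h₂ => (hB b₁ b₂ b h₁ h₂).imp hDmono hDmono, fun z => ?_⟩
  · rw [Equiv.symm_apply_eq]
    exact le_antisymm ((hD _ _).1 (hg _).1) ((hg _).2 ((hD _ _).2 le_rfl))
  · have hgmono : ∀ {S S' : NonemptyFiniteChains F}, S ≤ S' → g S ≤ g S' := fun h =>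
      (hg _).2 (h (hg _).1)
    have := hlub
      { finset := z.finset.image g
        comparable := by
          rintro ⟨_, h₁⟩ ⟨_, h₂⟩
          obtain ⟨S₁, hS₁, rfl⟩ := Finset.mem_image.1 h₁
          obtain ⟨S₂, hS₂, rfl⟩ := Finset.mem_image.1 h₂
          exact (z.comparable ⟨S₁, hS₁⟩ ⟨S₂, hS₂⟩).imp hgmono hgmono }
    rwa [Finset.coe_image, Set.image_image] at this

/-- A poset is a forest if elements with a common upper bound are comparable. -/
def IsForest (B : Type u) [PartialOrder B] : Prop :=
  ∀ a b c : B, a ≤ c → b ≤ c → a ≤ b ∨ b ≤ a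

/-- A poset has joins if all its nonempty subsets have a least upper bound. -/
def HasJoins (B : Type u) [PartialOrder B] : Prop :=
  ∀ S : Set B, S.Nonempty → ∃ s, IsLUB S s

/-- A forest serves as its own `F`, where each chain has a greatest element. With joins, any linear
extension works, since least upper bounds in `B` exist anyway. -/
lemma isAttachable_of_isForest_or_hasJoins {B : Type u} [PartialOrder B] [Finite B]
    (h : IsForest B ∨ HasJoins B) : IsAttachable B := by
  obtain h | h := h
  · refine isAttachable_of_forest (Equiv.refl B) h h fun S => ?_
    obtain ⟨g, hg⟩ := exists_isGreatest S
    exact ⟨g, by simpa using hg.isLUB⟩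
  · have : Finite (LinearExtension B) := ‹Finite B›
    exact isAttachable_of_forest (F := LinearExtension B) (Equiv.refl B)
      (fun a b c _ _ => le_total a b) (fun a b c _ _ => le_total _ _)
      fun S => h _ ((Finset.coe_nonempty.2 S.nonempty).image _)

lemma isForest_or_hasJoins_of_card_le_three {B : Type u} [PartialOrder B] [Finite B]
    (hB : Nat.card B ≤ 3) : IsForest B ∨ HasJoins B := by
  classical
  by_contra! H
  obtain ⟨h₁, h₂⟩ := H
  simp only [IsForest, not_forall, not_or] at h₁
  obtain ⟨a, b, c, hac, hbc, hab, hba⟩ := h₁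
  have hall : ∀ x : B, x = a ∨ x = b ∨ x = c := by
    intro x
    by_contra! hx
    have _ := Fintype.ofFinite B
    have hcard : ({x, a, b, c} : Finset B).card = 4 := by
      have h₁ : a ≠ b := fun h => hab h.le
      have h₂ : a ≠ c := fun h => hba (h ▸ hbc)
      have h₃ : b ≠ c := fun h => hab (h ▸ hac)
      simp [hx.1, hx.2.1, hx.2.2, h₁, h₂, h₃]
    have := Finset.card_le_univ ({x, a, b, c} : Finset B)
    rw [hcard, ← Nat.card_eq_fintype_card] at this
    omega
  refine h₂ fun S hS => ?_
  have hle : ∀ x : B, x ≤ c := fun x => by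
    obtain rfl | rfl | rfl := hall x <;> first | assumption | exact le_rfl
  by_cases hc : c ∈ S
  · exact ⟨c, fun x _ => hle x, fun u hu => hu hc⟩
  by_cases ha : a ∈ S
  · by_cases hb : b ∈ S
    · refine ⟨c, fun x _ => hle x, fun u hu => ?_⟩
      obtain rfl | rfl | rfl := hall u
      · exact absurd (hu hb) hba
      · exact absurd (hu ha) hab
      · exact le_rfl
    · refine ⟨a, fun x hx => ?_, fun u hu => hu ha⟩
      obtain rfl | rfl | rfl := hall x
      · exact le_rfl
      · exact absurd hx hb
      · exact absurd hx hc
  · have hb : ∀ x ∈ S, x = b := fun x hx => by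
      obtain rfl | rfl | rfl := hall x
      · exact absurd hx ha
      · rfl
      · exact absurd hx hc
    obtain ⟨y, hy⟩ := hS
    exact ⟨y, fun x hx => (hb x hx).trans (hb y hy).symm |>.le, fun u hu => hu hy⟩

lemma isForest_or_hasJoins_Ici {P : Type u} [PartialOrder P] (x : P)
    (h : IsForest {p : P // x < p} ∨ HasJoins {p : P // x < p}) :
    IsForest {p : P // x ≤ p} ∨ HasJoins {p : P // x ≤ p} := by
  refine h.imp (fun h a b c hac hbc => ?_) (fun h S hS => ?_)
  · obtain ha | ha := a.2.eq_or_lt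
    · exact Or.inl (show a.1 ≤ b.1 from ha ▸ b.2)
    obtain hb | hb := b.2.eq_or_lt
    · exact Or.inr (show b.1 ≤ a.1 from hb ▸ a.2)
    exact h ⟨a, ha⟩ ⟨b, hb⟩ ⟨c, ha.trans_le hac⟩ hac hbc
  · by_cases hS' : ∃ p ∈ S, x < p.1
    · obtain ⟨p, hp, hxp⟩ := hS'
      obtain ⟨s, hs⟩ := h {q | (⟨q.1, q.2.le⟩ : {p : P // x ≤ p}) ∈ S} ⟨⟨p, hxp⟩, hp⟩
      refine ⟨⟨s, s.2.le⟩, fun q hq => ?_, fun v hv => ?_⟩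
      · obtain hxq | hxq := q.2.eq_or_lt
        · exact show q.1 ≤ s.1 from hxq ▸ s.2.le
        · exact hs.1 (show (⟨q.1, hxq⟩ : {p : P // x < p}) ∈ _ from hq)
      · exact @hs.2 ⟨v.1, hxp.trans_le (hv hp)⟩ fun q hq => hv hq
    · push Not at hS'
      obtain ⟨p, hp⟩ := hS
      refine ⟨p, fun q hq => ?_, fun v hv => hv hp⟩
      obtain hxq | hxq := q.2.eq_or_lt
      · exact show q.1 ≤ p.1 from hxq ▸ p.2
      · exact absurd hxq (hS' q hq)

/-! ### Extending sections to one more element -/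

/-- Extension of sections to a minimal element. -/
lemma exists_section_of_isMin {P : Type u} [PartialOrder P] [Finite P] (x : P) (hx : IsMin x)
    (hB : IsForest {p : P // x < p} ∨ HasJoins {p : P // x < p})
    {X : Cat.{u, u}} (f : X ⟶ posToCat.obj (PartOrd.of P))
    (hf : trivialFibrations nerveFunctor.{u, u} f)
    (α : {p : P // p ≠ x} ⥤ X) (hα : ∀ p, f.toFunctor.obj (α.obj p) = p.1) :
    ∃ F : P ⥤ X, (∀ p, f.toFunctor.obj (F.obj p) = p) ∧
      ∀ p (hp : p ≠ x), ¬ x ≤ p → F.obj p = α.obj ⟨p, hp⟩ := by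
  classical
  let k : {p : P // x ≤ p} → WithBot {p : P // x < p} := fun v =>
    if h : x < v.1 then WithBot.some ⟨v.1, h⟩ else ⊥
  have hk₁ : ∀ v (h : x < v.1), k v = WithBot.some ⟨v.1, h⟩ := fun v h => dif_pos h
  have hk₂ : ∀ v, ¬ x < v.1 → k v = ⊥ := fun v h => dif_neg h
  refine exists_section_of_compl x (isAttachable_of_isForest_or_hasJoins hB)
    ⟨k, fun v v' h => ?_⟩ ⟨fun b => ⟨b, b.2.ne'⟩, fun _ _ h => h⟩ ⟨Subtype.val, fun _ _ h => h⟩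
    (fun b => le_rfl) (fun b => b.2.le) (fun v hv => ?_) (fun v b hv => ?_)
    (fun p v hp hpv => ?_) f hf α hα
  · by_cases hv : x < v.1
    · rw [hk₁ v hv, hk₁ v' (lt_of_lt_of_le hv h)]
      exact WithBot.coe_le_coe.2 h
    · rw [hk₂ v hv]
      exact bot_le
  · by_contra hne
    exact WithBot.coe_ne_bot ((hk₁ v (lt_of_le_of_ne v.2 (Ne.symm hne))).symm.trans hv)
  · by_cases h : x < v.1
    · exact congrArg Subtype.val (WithBot.coe_injective ((hk₁ v h).symm.trans hv))
    · exact absurd ((hk₂ v h).symm.trans hv) WithBot.bot_ne_coe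
  · have h : x < v.1 := lt_of_le_of_ne v.2 fun h => hp (hx (h ▸ hpv))
    exact ⟨⟨v.1, h⟩, hk₁ v h, hpv⟩

/-- Extension of sections to an element such that there is a greatest element `s` among the smaller
elements. -/
lemma exists_section_of_lt {P : Type u} [PartialOrder P] [Finite P] (x s : P) (hs : s < x)
    (hsx : ∀ p < x, p ≤ s)
    (hB : IsForest {p : P // x < p} ∨ HasJoins {p : P // x < p})
    {X : Cat.{u, u}} (f : X ⟶ posToCat.obj (PartOrd.of P))
    (hf : trivialFibrations nerveFunctor.{u, u} f)
    (α : {p : P // p ≠ x} ⥤ X) (hα : ∀ p, f.toFunctor.obj (α.obj p) = p.1) :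
    ∃ F : P ⥤ X, (∀ p, f.toFunctor.obj (F.obj p) = p) ∧
      ∀ p (hp : p ≠ x), ¬ x ≤ p → F.obj p = α.obj ⟨p, hp⟩ := by
  classical
  -- The section is not yet defined at `x`, so its value at `s` stands in. Everything below `x` lies
  -- below `s`, so all required morphisms still factor through `w`.
  let w : {p : P // x ≤ p} → {p : P // p ≠ x} := fun b =>
    if h : b.1 = x then ⟨s, hs.ne⟩ else ⟨b.1, h⟩
  have hw₁ : ∀ b, b.1 = x → (w b).1 = s := fun b h => by simp [w, h]
  have hw₂ : ∀ b, b.1 ≠ x → (w b).1 = b.1 := fun b h => by simp [w, h]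
  refine exists_section_of_compl x
    (isAttachable_of_isForest_or_hasJoins (isForest_or_hasJoins_Ici x hB))
    ⟨WithBot.some, WithBot.coe_mono⟩ ⟨w, fun b b' h => show (w b).1 ≤ (w b').1 from ?_⟩
    ⟨Subtype.val, fun _ _ h => h⟩
    (fun b => show (w b).1 ≤ b.1 from ?_) (fun b => b.2) (fun v hv => absurd hv WithBot.coe_ne_bot)
    (fun v b hv => congrArg Subtype.val (WithBot.coe_injective hv))
    (fun p v hp hpv => ⟨v, rfl, show p ≤ (w v).1 from ?_⟩) f hf α hα
  · by_cases hb : b.1 = x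
    · by_cases hb' : b'.1 = x
      · rw [hw₁ b hb, hw₁ b' hb']
      · rw [hw₁ b hb, hw₂ b' hb']
        exact hs.le.trans b'.2
    · have hb' : b'.1 ≠ x := fun hb' =>
        hb (le_antisymm (le_trans (show b.1 ≤ b'.1 from h) hb'.le) b.2)
      rwa [hw₂ b hb, hw₂ b' hb']
  · by_cases hb : b.1 = x
    · rw [hw₁ b hb, hb]
      exact hs.le
    · rw [hw₂ b hb]
  · by_cases hv : v.1 = x
    · rw [hw₁ v hv]
      exact hsx p (lt_of_le_of_ne (hpv.trans hv.le) fun h => hp h.ge)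
    · rwa [hw₂ v hv]

/-! ### Cofibrations and sections -/

lemma trivialFibrations_of_isPullback {X' X Y' Y : Cat.{u, u}} {f' : X' ⟶ Y'} {f : X ⟶ Y}
    {a : X' ⟶ X} {b : Y' ⟶ Y} (h : IsPullback a f' f b)
    (hf : trivialFibrations nerveFunctor.{u, u} f) :
    trivialFibrations nerveFunctor.{u, u} f' := by
  have : nerveFunctor.{u, u}.IsRightAdjoint := nerveAdjunction.isRightAdjoint
  exact MorphismProperty.of_isPullback (P := SSet.modelCategoryQuillen.I.{u}.rlp)
    (h.map (nerveFunctor ⋙ SSet.ex ⋙ SSet.ex)) hf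

/-- The trivial fibrations of categories have the right lifting property with respect to `A ⟶ P`
if those with codomain `P` have sections extending a given partial section on `A`. -/
lemma cofibrations_of_sections {A P : Cat.{u, u}} (i : A ⟶ P)
    (h : ∀ (X : Cat.{u, u}) (f : X ⟶ P), trivialFibrations nerveFunctor.{u, u} f →
      ∀ t : A ⟶ X, t ≫ f = i → ∃ s : P ⟶ X, i ≫ s = t ∧ s ≫ f = 𝟙 P) :
    cofibrations nerveFunctor.{u, u} i := by
  intro X Y f hf
  constructor
  intro t b sq
  obtain ⟨s, hs₁, hs₂⟩ := h (pullback f b) (pullback.snd f b)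
    (trivialFibrations_of_isPullback (IsPullback.of_hasPullback f b) hf)
    (pullback.lift t i sq.w) (pullback.lift_snd _ _ _)
  refine ⟨⟨s ≫ pullback.fst f b, ?_, ?_⟩⟩
  · rw [← Category.assoc, hs₁, pullback.lift_fst]
  · rw [Category.assoc, pullback.condition, ← Category.assoc, hs₂, Category.id_comp]

lemma functor_ext_of_forall_eq_eqToHom {C D : Type*} [Category* C] [Category* D] {F G : C ⥤ D}
    (hC : ∀ (a b : C) (g : a ⟶ b), ∃ h : a = b, g = eqToHom h) (h : ∀ a, F.obj a = G.obj a) :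
    F = G := by
  refine CategoryTheory.Functor.ext h fun a b g => ?_
  obtain ⟨rfl, rfl⟩ := hC a b g
  simp

lemma hom_ext_of_punit {X : Cat.{u, u}} {s t : posToCat.obj (PartOrd.of PUnit.{u + 1}) ⟶ X}
    (h : s.toFunctor.obj PUnit.unit = t.toFunctor.obj PUnit.unit) : s = t :=
  Cat.Hom.ext (functor_ext_of_forall_eq_eqToHom
    (fun _ _ _ => ⟨rfl, Subsingleton.elim (α := ULift (PLift _)) _ _⟩) fun _ => h)

/-- The functor `1 ⟶ X` with value `x`. -/
def pointHom {X : Cat.{u, u}} (x : X) : posToCat.obj (PartOrd.of PUnit.{u + 1}) ⟶ X :=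
  ((Functor.const PUnit.{u + 1}).obj x : PUnit.{u + 1} ⥤ X).toCatHom

lemma cofibrations_pointInclusion_of_sections {P : Type u} [PartialOrder P] (m : P)
    (h : ∀ (X : Cat.{u, u}) (f : X ⟶ posToCat.obj (PartOrd.of P)),
      trivialFibrations nerveFunctor.{u, u} f → ∀ x₀ : X, f.toFunctor.obj x₀ = m →
      ∃ F : P ⥤ X, (∀ p, f.toFunctor.obj (F.obj p) = p) ∧ F.obj m = x₀) :
    cofibrations nerveFunctor.{u, u} (posToCat.map (pointInclusion m)) := by
  refine cofibrations_of_sections _ fun X f hf t ht => ?_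
  obtain ⟨F, hF, hFm⟩ := h X f hf (t.toFunctor.obj PUnit.unit)
    (congrArg (fun g => g.toFunctor.obj PUnit.unit) ht)
  exact ⟨F.toCatHom, hom_ext_of_punit hFm, Cat.Hom.ext (functor_ext_of_obj (P := P) hF)⟩

lemma exists_lift_of_cofibrations_pointInclusion {P : Type u} [PartialOrder P] {m : P}
    (h : cofibrations nerveFunctor.{u, u} (posToCat.map (pointInclusion m)))
    {X Y : Cat.{u, u}} (f : X ⟶ Y) (hf : trivialFibrations nerveFunctor.{u, u} f)
    (b : posToCat.obj (PartOrd.of P) ⟶ Y) (x₀ : X)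
    (hx₀ : f.toFunctor.obj x₀ = b.toFunctor.obj m) :
    ∃ s : posToCat.obj (PartOrd.of P) ⟶ X, s ≫ f = b ∧ s.toFunctor.obj m = x₀ := by
  have sq : CommSq (pointHom x₀) (posToCat.map (pointInclusion m)) f b := ⟨hom_ext_of_punit hx₀⟩
  have : HasLiftingProperty (posToCat.map (pointInclusion m)) f := h f hf
  exact ⟨sq.lift, sq.fac_right, congrArg (fun g => g.toFunctor.obj PUnit.unit) sq.fac_left⟩

/-! ### Induction on the number of elements -/

/-- In a poset with at most five elements, an element other than a given minimal element `m` can be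
found to which sections of trivial fibrations extend. -/
lemma exists_ne_extension {P : Type u} [PartialOrder P] [Finite P] (hP : Nat.card P ≤ 5) (m : P)
    (hm : IsMin m) (h : ∃ p, p ≠ m) :
    ∃ x ≠ m, ∀ (X : Cat.{u, u}) (f : X ⟶ posToCat.obj (PartOrd.of P)),
      trivialFibrations nerveFunctor.{u, u} f →
      ∀ α : {p : P // p ≠ x} ⥤ X, (∀ p, f.toFunctor.obj (α.obj p) = p.1) →
        ∃ F : P ⥤ X, (∀ p, f.toFunctor.obj (F.obj p) = p) ∧
          ∀ p (hp : p ≠ x), ¬ x ≤ p → F.obj p = α.obj ⟨p, hp⟩ := by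
  classical
  have hcard : ∀ x, x ≠ m → ¬ x ≤ m →
      IsForest {p : P // x < p} ∨ HasJoins {p : P // x < p} := by
    intro x hx hxm
    refine isForest_or_hasJoins_of_card_le_three ?_
    have hlt : ∀ S : Set P, S ⊆ {x, m}ᶜ → Nat.card S ≤ 3 := by
      intro S hS
      have h₁ := Set.ncard_le_ncard hS (Set.toFinite _)
      have h₂ := Set.ncard_add_ncard_compl ({x, m} : Set P)
      rw [Set.ncard_pair hx] at h₂
      change S.ncard ≤ 3
      omega
    refine hlt {p | x < p} fun p hp => ?_
    rintro (rfl | rfl)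
    · exact lt_irrefl _ hp
    · exact hxm (le_of_lt hp)
  by_cases hbot : ∀ p, m ≤ p
  -- When `m` is the least element, an atom `x` has only `m` strictly below it, so `m` plays the
  -- role of `s`.
  · obtain ⟨x, -, hx⟩ := (Set.toFinite {p : P | p ≠ m}).exists_le_minimal h.choose_spec
    have hmx : m < x := lt_of_le_of_ne (hbot x) hx.1.symm
    refine ⟨x, hx.1, fun X f hf α hα => exists_section_of_lt x m hmx (fun p hp => ?_)
      (hcard x hx.1 hmx.not_ge) f hf α hα⟩
    by_contra hpm
    exact hp.not_ge (hx.2 (fun h => hpm h.le) hp.le)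
  · push Not at hbot
    obtain ⟨y, hy⟩ := hbot
    obtain ⟨x, hxy, hx⟩ := (Set.toFinite (Set.univ : Set P)).exists_le_minimal (Set.mem_univ y)
    have hxmin : IsMin x := fun z hz => hx.2 (Set.mem_univ z) hz
    have hxm : x ≠ m := fun h => hy (h ▸ hxy)
    exact ⟨x, hxm, fun X f hf α hα => exists_section_of_isMin x hxmin
      (hcard x hxm fun h => hxm (le_antisymm h (hm h))) f hf α hα⟩

theorem cofibrations_pointInclusion_of_card_le_five {P : Type u} [PartialOrder P] [Finite P]
    (hP : Nat.card P ≤ 5) (m : P) (hm : IsMin m) :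
    cofibrations nerveFunctor.{u, u} (posToCat.map (pointInclusion m)) := by
  induction hn : Nat.card P using Nat.strong_induction_on generalizing P with
  | _ n ih =>
    refine cofibrations_pointInclusion_of_sections m fun X f hf x₀ hx₀ => ?_
    by_cases h : ∃ p, p ≠ m
    · obtain ⟨x, hxm, hx⟩ := exists_ne_extension hP m hm h
      have hlt : Nat.card {p : P // p ≠ x} < Nat.card P :=
        Finite.card_subtype_lt (x := x) (by simp)
      obtain ⟨s, hs₁, hs₂⟩ := exists_lift_of_cofibrations_pointInclusion
        (ih _ (hn ▸ hlt) (hlt.le.trans hP) (⟨m, hxm.symm⟩ : {p : P // p ≠ x})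
          (fun _ hz => hm hz) rfl) f hf
        (posToCat.map (PartOrd.ofHom ⟨Subtype.val, fun _ _ h => h⟩)) x₀ hx₀
      obtain ⟨F, hF₁, hF₂⟩ := hx X f hf s.toFunctor
        (fun p => congrArg (fun g => g.toFunctor.obj p) hs₁)
      exact ⟨F, hF₁, (hF₂ m hxm.symm fun h => hxm (le_antisymm h (hm h))).trans hs₂⟩
    · push Not at h
      exact ⟨(Functor.const P).obj x₀, fun p => hx₀.trans (h p).symm, rfl⟩

/-- Trivial fibrations of categories over a poset are surjective on objects. -/
lemma exists_obj_eq_of_trivialFibrations {P : Type u} [PartialOrder P] {X : Cat.{u, u}}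
    (f : X ⟶ posToCat.obj (PartOrd.of P)) (hf : trivialFibrations nerveFunctor.{u, u} f) (x : P) :
    ∃ x₀ : X, f.toFunctor.obj x₀ = x := by
  -- Attaching along the empty poset adds just a bottom element, that is, a point over `x`.
  let p : PEmpty.{u + 1} →o P := ⟨PEmpty.elim, fun a => a.elim⟩
  obtain ⟨γ, hγ, -⟩ := exists_cell_lift
    (isAttachable_of_isForest_or_hasJoins (Or.inl fun a : PEmpty.{u + 1} => a.elim)) f hf p p x
    le_rfl (fun b => b.elim)
    { obj := fun a => a.elim, map := fun {a} => a.elim, map_id := fun a => a.elim,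
      map_comp := fun {a} => a.elim } (fun b => b.elim)
  exact ⟨_, hγ⟩

lemma exists_lift_of_card_le_five {P : Type u} [PartialOrder P] [Finite P] (hP : Nat.card P ≤ 5)
    {X Y : Cat.{u, u}} (f : X ⟶ Y) (hf : trivialFibrations nerveFunctor.{u, u} f)
    (b : posToCat.obj (PartOrd.of P) ⟶ Y) : ∃ s, s ≫ f = b := by
  obtain hP' | ⟨⟨y⟩⟩ := isEmpty_or_nonempty P
  · let F : P ⥤ X :=
      { obj := fun a => isEmptyElim a, map := fun {a} => isEmptyElim a,
        map_id := fun a => isEmptyElim a, map_comp := fun {a} => isEmptyElim a }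
    exact ⟨F.toCatHom, Cat.Hom.ext (CategoryTheory.Functor.ext
      (fun a => isEmptyElim (α := P) a) fun a => isEmptyElim (α := P) a)⟩
  · obtain ⟨m, -, hm⟩ := (Set.toFinite (Set.univ : Set P)).exists_le_minimal (Set.mem_univ y)
    have hmmin : IsMin m := fun z hz => hm.2 (Set.mem_univ z) hz
    obtain ⟨x₀, hx₀⟩ := exists_obj_eq_of_trivialFibrations (pullback.snd f b)
      (trivialFibrations_of_isPullback (IsPullback.of_hasPullback f b) hf) m
    obtain ⟨s, hs, -⟩ := exists_lift_of_cofibrations_pointInclusion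
      (cofibrations_pointInclusion_of_card_le_five hP m hmmin) f hf b
      ((pullback.fst f b).toFunctor.obj x₀)
      ((congrArg (fun g => g.toFunctor.obj x₀) (pullback.condition (f := f) (g := b))).trans
        (congrArg b.toFunctor.obj hx₀))
    exact ⟨s, hs⟩

/-! ### Passage from categories to posets and acyclic categories -/

/-- A morphism is a cofibration for the structure transferred along `F ⋙ N` with `F` fully faithful
if its image under `F` is a cofibration for the structure transferred along `N`. -/
lemma cofibrations_of_fullyFaithful {C : Type*} [Category* C] (F : C ⥤ Cat.{u, u}) [F.Full]
    [F.Faithful] {A B : C} (i : A ⟶ B) (hi : cofibrations nerveFunctor.{u, u} (F.map i)) :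
    cofibrations (F ⋙ nerveFunctor.{u, u}) i := by
  intro X Y f hf
  constructor
  intro t b sq
  have : HasLiftingProperty (F.map i) (F.map f) := hi _ hf
  have sq' := sq.map F
  exact ⟨⟨F.preimage sq'.lift, F.map_injective (by simp), F.map_injective (by simp)⟩⟩

lemma cofibrations_initial_to {C : Type*} [Category* C] [HasInitial C] (F : C ⥤ Cat.{u, u})
    [F.Full] [F.Faithful] (B : C)
    (hB : ∀ {X Y : Cat.{u, u}} (f : X ⟶ Y), trivialFibrations nerveFunctor.{u, u} f →
      ∀ b : F.obj B ⟶ Y, ∃ s, s ≫ f = b) :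
    cofibrations (F ⋙ nerveFunctor.{u, u}) (initial.to B) := by
  intro X Y f hf
  constructor
  intro t b sq
  obtain ⟨s, hs⟩ := hB (F.map f) hf (F.map b)
  exact ⟨⟨F.preimage s, initial.hom_ext _ _, F.map_injective (by simpa using hs)⟩⟩

instance : posToCat.{u}.Faithful where
  map_injective {P Q f g} h := by
    ext x
    exact congrArg (fun k => k.toFunctor.obj x) h

instance : posToCat.{u}.Full where
  map_surjective {P Q} f :=
    ⟨PartOrd.ofHom ⟨fun x => f.toFunctor.obj x,
      fun _ _ h => leOfHom (f.toFunctor.map (homOfLE (X := P) h))⟩,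
      Cat.Hom.ext (functor_ext_of_obj (P := Q) fun _ => rfl)⟩

end Thomason

theorem mainTheorem1 (P : Type u) [PartialOrder P] [Finite P] (hP : Nat.card P ≤ 5) :
    -- in posets
    (IsCofibrant (PartOrd.of P) ∧
      ∀ m : P, IsMin m → Cofibration (Thomason.pointInclusion m)) ∧
    -- in small acyclic categories
    (IsCofibrant (Thomason.posToAc.obj (PartOrd.of P)) ∧
      ∀ m : P, IsMin m → Cofibration (Thomason.posToAc.map (Thomason.pointInclusion m))) ∧
    -- in small categories
    (IsCofibrant (Thomason.posToCat.obj (PartOrd.of P)) ∧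
      ∀ m : P, IsMin m → Cofibration (Thomason.posToCat.map (Thomason.pointInclusion m))) := by
  have h := fun m hm => Thomason.cofibrations_pointInclusion_of_card_le_five hP m hm
  refine ⟨⟨⟨?_⟩, fun m hm => ⟨?_⟩⟩, ⟨⟨?_⟩, fun m hm => ⟨?_⟩⟩, ⟨⟨?_⟩, fun m hm => ⟨h m hm⟩⟩⟩
  · exact Thomason.cofibrations_initial_to Thomason.posToCat _
      (Thomason.exists_lift_of_card_le_five hP)
  · exact Thomason.cofibrations_of_fullyFaithful Thomason.posToCat _ (h m hm)
  · exact Thomason.cofibrations_initial_to Thomason.acToCat _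
      (Thomason.exists_lift_of_card_le_five hP)
  · exact Thomason.cofibrations_of_fullyFaithful Thomason.acToCat _ (h m hm)
  · exact Thomason.cofibrations_initial_to (𝟭 Cat) _
      (Thomason.exists_lift_of_card_le_five hP)
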